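/- All groups are finite. Let $p$ be an odd prime, let $G$ be a finite group and $P\in \mathrm{Syl}_p(G)$, and write $O_p(G)$ for the largest normal $p$-subgroup of $G$. Suppose that $G$ is $p$-stable, i.e. whenever $Q$ is a $p$-subgroup of $G$, $g\in N_G(Q)$ and $[[Q,g],g]=1$ (where $[H,g]$ is the subgroup generated by the $x^{-1}g^{-1}xg$ with $x\in H$), the coset $gC_G(Q)$ lies in $O_p(N_G(Q)/C_G(Q))$. Suppose also that $C_G(O_p(G))\le O_p(G)$. Let $D\le P$ be a subgroup that is strongly closed in $P$ with respect to $G$, i.e. for all $U\subseteq D$ and $g\in G$ such that $U^g=g^{-1}Ug\subseteq P$ we have $U^g\subseteq D$. For a $p$-group $H$ let $J_o(H)$, $J_r(H)$ and $J_e(H)$ be the subgroups of $H$ generated, respectively, by all abelian subgroups of $H$ of maximal order, by all abelian subgroups of $H$ of maximal rank (the rank being the minimal number of generators), and by all elementary abelian subgroups of $H$ of maximal order; maximal means attaining the maximum over all abelian (respectively elementary abelian) subgroups of $H$. Let $\Omega(H)=\langle x\in H\mid x^p=1\rangle$, and let $Z(H)$ be the center of $H$. Then $Z(J_o(D))$,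 $\Omega(Z(J_r(D)))$ and $\Omega(Z(J_e(D)))$ are normal subgroups of $G$. -/

import Mathlib

namespace ThompsonZJ

/-- `O_p(G)`: the subgroup generated by all normal `p`-subgroups of `G`
(for finite `G`, the largest normal `p`-subgroup). -/
def pCore (p : ℕ) (G : Type*) [Group G] : Subgroup G :=
  sSup {N : Subgroup G | N.Normal ∧ IsPGroup p N}

/-- `C_G(H)` is a normal subgroup of `N_G(H)`. -/
instance centralizer_subgroupOf_normalizer_normal {G : Type*} [Group G] (H : Subgroup G) :
    ((Subgroup.centralizer (H : Set G)).subgroupOf (Subgroup.normalizer (H : Set G))).Normal := by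
  rw [← Subgroup.normalizerMonoidHom_ker]
  infer_instance

/-- `[H, g]`: the subgroup generated by the commutators `[x, g] = x⁻¹ g⁻¹ x g`
with `x ∈ H`. -/
def commutatorWith {G : Type*} [Group G] (H : Subgroup G) (g : G) : Subgroup G :=
  Subgroup.closure {c : G | ∃ x ∈ H, c = x⁻¹ * g⁻¹ * x * g}

/-- `G` is `p`-stable: whenever `Q` is a `p`-subgroup of `G`, `g ∈ N_G(Q)` and `[Q, g, g] = 1`,
the coset `g C_G(Q)` lies in `O_p(N_G(Q) / C_G(Q))`. -/
def IsPStable (p : ℕ) (G : Type*) [Group G] : Prop :=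
  ∀ Q : Subgroup G, IsPGroup p Q →
    ∀ g : Subgroup.normalizer (Q : Set G),
      commutatorWith (commutatorWith Q (g : G)) (g : G) = ⊥ →
      (QuotientGroup.mk g : Subgroup.normalizer (Q : Set G) ⧸
          (Subgroup.centralizer (Q : Set G)).subgroupOf (Subgroup.normalizer (Q : Set G))) ∈
        pCore p (Subgroup.normalizer (Q : Set G) ⧸
          (Subgroup.centralizer (Q : Set G)).subgroupOf (Subgroup.normalizer (Q : Set G)))

/-- The nonempty subset `D` of `P` is strongly closed in `P` with respect to `G`: for all
`U ⊆ D` and `g ∈ G` with `U^g = g⁻¹ U g ⊆ P`, one has `U^g ⊆ D`. -/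
def IsStronglyClosed {G : Type*} [Group G] (P : Subgroup G) (D : Set G) : Prop :=
  D.Nonempty ∧ D ⊆ P ∧
    ∀ U : Set G, U ⊆ D → ∀ g : G,
      (fun u : G => g⁻¹ * u * g) '' U ⊆ P → (fun u : G => g⁻¹ * u * g) '' U ⊆ D

section Thompson

variable {G : Type*} [Group G]

/-- The abelian subgroups of `H`. -/
def abelianSubgroups (H : Subgroup G) : Set (Subgroup G) :=
  {A : Subgroup G | A ≤ H ∧ ∀ x ∈ A, ∀ y ∈ A, x * y = y * x}

/-- The elementary abelian `p`-subgroups of `H` (the trivial subgroup is one of them). -/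
def elemAbelianSubgroups (p : ℕ) (H : Subgroup G) : Set (Subgroup G) :=
  {A : Subgroup G | A ∈ abelianSubgroups H ∧ ∀ x ∈ A, x ^ p = 1}

/-- `𝒜_o(H)`: the abelian subgroups of `H` whose order is the maximum `d_o(H)` of the orders
of abelian subgroups of `H`. -/
def maxOrderAbelian (H : Subgroup G) : Set (Subgroup G) :=
  {A : Subgroup G | A ∈ abelianSubgroups H ∧
    IsGreatest {n : ℕ | ∃ B ∈ abelianSubgroups H, n = Nat.card B} (Nat.card A)}

/-- `𝒜_r(H)`: the abelian subgroups of `H` whose rank (minimal number of generators) is the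
maximum `d_r(H)` of the ranks of abelian subgroups of `H`. -/
def maxRankAbelian [Finite G] (H : Subgroup G) : Set (Subgroup G) :=
  {A : Subgroup G | A ∈ abelianSubgroups H ∧
    IsGreatest {n : ℕ | ∃ B ∈ abelianSubgroups H, n = Group.rank B} (Group.rank A)}

/-- `𝒜_e(H)`: the elementary abelian `p`-subgroups of `H` whose order is the maximum `d_e(H)`
of the orders of elementary abelian `p`-subgroups of `H`. -/
def maxOrderElemAbelian (p : ℕ) (H : Subgroup G) : Set (Subgroup G) :=
  {A : Subgroup G | A ∈ elemAbelianSubgroups p H ∧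
    IsGreatest {n : ℕ | ∃ B ∈ elemAbelianSubgroups p H, n = Nat.card B} (Nat.card A)}

/-- The Thompson subgroup `J_o(H)`. -/
def thompsonO (H : Subgroup G) : Subgroup G := sSup (maxOrderAbelian H)

/-- The Thompson subgroup `J_r(H)`. -/
def thompsonR [Finite G] (H : Subgroup G) : Subgroup G := sSup (maxRankAbelian H)

/-- The Thompson subgroup `J_e(H)`. -/
def thompsonE (p : ℕ) (H : Subgroup G) : Subgroup G := sSup (maxOrderElemAbelian p H)

/-- The center `Z(H)` of a subgroup `H` of `G`, as a subgroup of `G`. -/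
def centerOf (H : Subgroup G) : Subgroup G := (Subgroup.center H).map H.subtype

/-- `Ω(H)`: the subgroup generated by the elements `x ∈ H` with `x ^ p = 1`. -/
def omega (p : ℕ) (H : Subgroup G) : Subgroup G :=
  Subgroup.closure {x : G | x ∈ H ∧ x ^ p = 1}

end Thompson

end ThompsonZJ

/-! Each of the three groups is an intersection `Z` of a family `𝒜` of abelian subgroups of `D`:
those of maximal order for `J_o`, the elementary abelian ones of maximal order for both `J_e` and
`J_r`.

The heart is `inf_sInf_normal`: `Z ⊓ B` is normal for every normal `p`-subgroup `B`. In a minimal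
counterexample `B` is the normal closure of `Z ⊓ B`, lies in `D` by strong closure, and has central
commutators lying in `Z`. Let `L` be the normal core of `N_G(Z ⊓ B)`, so that `G = N_G(P ⊓ L) L` by
Frattini. If every member of `𝒜` lies in `L`, then `N_G(P ⊓ L)` preserves `Z`, a contradiction.
Otherwise take `A` outside `L` with `A ⊓ B` as large as possible. If `B` normalises `A`, then `[B,
a, a] = 1` for `a ∈ A` and `p`-stability puts `A` inside `L`. If not, the replacement theorem
`exists_abelian_replacement` (where `p` odd is used) gives a member `C` normalising `A` with larger
`C ⊓ B`; so `C ≤ L`, and then `B ≤ C` by Frattini, so `B` normalises `A` after all.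

Finally `p`-stability and `C_G(O_p(G)) ≤ O_p(G)` give `Z ≤ O_p(G)`, so `B = O_p(G)` finishes the
proof. -/

namespace ThompsonZJ

open scoped commutatorElement

/-! ### The replacement theorem for abelian subgroups -/

section Replacement

variable {G : Type*} [Group G]

theorem exists_mem_normalizer_of_lt [Finite G] {p : ℕ} [Fact p.Prime] {S N : Subgroup G}
    (hS : IsPGroup p S) (hN : N < S) :
    ∃ x ∈ S, x ∉ N ∧ x ∈ Subgroup.normalizer (N : Set G) := by
  have := hS.isNilpotent
  have hlt : N.subgroupOf S < ⊤ := by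
    rw [lt_top_iff_ne_top, Ne, Subgroup.subgroupOf_eq_top]
    exact hN.not_ge
  obtain ⟨x, hx, hxN⟩ := SetLike.exists_of_lt (Group.normalizerCondition_of_isNilpotent _ hlt)
  refine ⟨x, x.2, fun h => hxN (Subgroup.mem_subgroupOf.2 h), ?_⟩
  rw [Subgroup.mem_normalizer_iff] at hx ⊢
  intro h
  constructor
  · intro hh
    exact Subgroup.mem_subgroupOf.1 ((hx ⟨h, hN.le hh⟩).1 (Subgroup.mem_subgroupOf.2 hh))
  · intro hh
    have hS' : h ∈ S := by
      have := S.mul_mem (S.mul_mem (S.inv_mem x.2) (hN.le hh)) x.2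
      simpa [mul_assoc] using this
    exact Subgroup.mem_subgroupOf.1 ((hx ⟨h, hS'⟩).2 (Subgroup.mem_subgroupOf.2 hh))

theorem mul_pow_of_mul_eq {u v z : G} (h : u * v = v * u * z) (hu : Commute z u)
    (hv : Commute z v) (n : ℕ) : (v * u) ^ n = v ^ n * u ^ n * z ^ n.choose 2 := by
  have h2 : ∀ n : ℕ, u ^ n * v = v * u ^ n * z ^ n := by
    intro n
    induction n with
    | zero => simp
    | succ n ih =>
      calc u ^ (n + 1) * v = u ^ n * (u * v) := by rw [pow_succ, mul_assoc]
        _ = (u ^ n * v) * (u * z) := by rw [h]; simp only [mul_assoc]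
        _ = v * u ^ n * (z ^ n * u) * z := by rw [ih]; simp only [mul_assoc]
        _ = v * u ^ (n + 1) * z ^ (n + 1) := by
          rw [(hu.pow_left n).eq]; simp only [pow_succ, mul_assoc]
  induction n with
  | zero => simp
  | succ n ih =>
    calc (v * u) ^ (n + 1) = v ^ n * u ^ n * (z ^ n.choose 2 * (v * u)) := by
          rw [pow_succ, ih]; simp only [mul_assoc]
      _ = v ^ n * (u ^ n * v) * (u * z ^ n.choose 2) := by
          rw [((hv.mul_right hu).pow_left _).eq]; simp only [mul_assoc]
      _ = v ^ n * v * u ^ n * (z ^ n * u) * z ^ n.choose 2 := by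
          rw [h2]; simp only [mul_assoc]
      _ = v ^ (n + 1) * u ^ (n + 1) * z ^ (n + 1).choose 2 := by
          have e : (n + 1).choose 2 = n + n.choose 2 := by simp [Nat.choose_succ_succ' n 1]
          rw [(hu.pow_left n).eq, e, pow_add z, pow_succ v n, pow_succ u n]
          simp only [mul_assoc]

/-- In the class-two power formula the commutator appears to the power `p.choose 2`, which `p`
divides because `p` is odd. -/
theorem mul_pow_prime_eq_one {p : ℕ} (hp : p.Prime) (hodd : Odd p) {u v z : G}
    (h : u * v = v * u * z) (hu : Commute z u) (hv : Commute z v) (hup : u ^ p = 1)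
    (hvp : v ^ p = 1) (hzp : z ^ p = 1) : (v * u) ^ p = 1 := by
  have h2 : p ∣ p.choose 2 := by
    refine hp.dvd_choose_self two_ne_zero (lt_of_le_of_ne hp.two_le ?_)
    rintro rfl
    exact absurd hodd (by decide)
  obtain ⟨k, hk⟩ := h2
  rw [mul_pow_of_mul_eq h hu hv, hup, hvp, hk, pow_mul, hzp]
  simp

/-- If two abelian subgroups normalise each other, their commutators lie in the intersection. -/
theorem commutator_mem_inf_of_normalize {A A' : Subgroup G}
    (h : A ≤ Subgroup.normalizer (A' : Set G)) (h' : A' ≤ Subgroup.normalizer (A : Set G))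
    {a t : G} (ha : a ∈ A) (ht : t ∈ A') : t⁻¹ * a⁻¹ * t * a ∈ A ⊓ A' := by
  refine ⟨A.mul_mem ?_ ha, ?_⟩
  · have := (Subgroup.mem_normalizer_iff.1 (h' (A'.inv_mem ht)) a⁻¹).1 (A.inv_mem ha)
    simpa using this
  · have := A'.mul_mem (A'.inv_mem ht)
      ((Subgroup.mem_normalizer_iff.1 (h (A.inv_mem ha)) t).1 ht)
    simpa [mul_assoc] using this

/-- In a group `B` with central commutators, if `c` centralises `⁅x, y⁆`, then the commutator of
`x` with `w = [y, c]` is determined by those of `z = [x, c]`. -/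
theorem commutator_eq_of_conj_invariant {B : Subgroup G}
    (hB : ∀ u ∈ B, ∀ v ∈ B, ∀ w ∈ B, Commute ⁅u, v⁆ w)
    {x y z w c : G} (hx : x ∈ B) (hy : y ∈ B) (hz : z ∈ B) (hw : w ∈ B)
    (hc : Commute ⁅x, y⁆ c) (hxc : c⁻¹ * x * c = x * z⁻¹) (hyc : c⁻¹ * y * c = y * w)
    (hzw : Commute z w) : ⁅x, w⁆ = ⁅z, y⁆ := by
  -- Conjugation by `c` fixes `⁅x, y⁆`; expanding the conjugate bilinearly, with `⁅z⁻¹, w⁆ = 1`,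
  -- gives the claim.
  have h1 : ⁅x * z⁻¹, y * w⁆ = ⁅x, y⁆ := by
    have := hc.inv_right.symm.eq
    rw [← hxc, ← hyc]
    have e := conjugate_commutatorElement x y c⁻¹
    rw [inv_inv] at e
    rw [← e, this]
    simp
  have hzi : z⁻¹ ∈ B := B.inv_mem hz
  have h2 : ⁅x * z⁻¹, y * w⁆ = ⁅z, y⁆⁻¹ * (⁅x, y⁆ * ⁅x, w⁆) := by
    rw [commutatorElement_mul_left_eq_conj_mul]
    have e1 : ⁅z⁻¹, y * w⁆ = ⁅z, y⁆⁻¹ := by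
      rw [commutatorElement_mul_right_eq_mul_conj,
        (commutatorElement_eq_one_iff_commute.2 hzw.inv_left), commutatorElement_inv_left,
        ← commutatorElement_inv]
      have := (hB z hz y hy z hz).inv_left.symm
      simp only [mul_one]
      rw [mul_inv_cancel_right, mul_assoc, ← this.eq, inv_mul_cancel_left]
    have e2 : ⁅x, y * w⁆ = ⁅x, y⁆ * ⁅x, w⁆ := by
      rw [commutatorElement_mul_right_eq_mul_conj, mul_assoc ⁅x, y⁆, ← (hB x hx w hw y hy).eq]
      simp [mul_assoc]
    rw [e1, e2, ← ((hB z hz y hy x hx).inv_left).eq, mul_inv_cancel_right]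
  rw [h2] at h1
  have e3 := (hB z hz y hy ⁅x, y⁆ (by
    rw [commutatorElement_def]
    exact B.mul_mem (B.mul_mem (B.mul_mem hx hy) (B.inv_mem hx)) (B.inv_mem hy))).inv_left.eq
  rw [← mul_assoc, e3, mul_assoc] at h1
  exact (inv_mul_eq_one.1 (mul_eq_left.1 h1)).symm

/-- Put `y_a = a⁻¹ a^x`. The map `aT ↦ y_a T` from `A/T` to `C/T` is injective: `y_{ac} = y_a^c y_c`
lies in `y_a T y_c`, so equal cosets force `y_c ∈ T`, and then `x c x⁻¹ ∈ A`, that is, `c ∈ T`. -/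
theorem card_le_card_of_conj_quotient [Finite G] {A C T : Subgroup G} {x : G}
    (hT : ∀ t, t ∈ T ↔ t ∈ A ∧ x * t * x⁻¹ ∈ A)
    (hTC : T ≤ C) (hy : ∀ a ∈ A, a⁻¹ * (x⁻¹ * a * x) ∈ C)
    (hcomm : ∀ a ∈ A, ∀ b ∈ A, ∃ t ∈ T,
      b⁻¹ * (a⁻¹ * (x⁻¹ * a * x)) * b = (a⁻¹ * (x⁻¹ * a * x)) * t) :
    Nat.card A ≤ Nat.card C := by
  have hTA : T ≤ A := fun t ht => ((hT t).1 ht).1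
  have key : ∀ a ∈ A, ∀ b ∈ A,
      (a⁻¹ * (x⁻¹ * a * x))⁻¹ * (b⁻¹ * (x⁻¹ * b * x)) ∈ T → a⁻¹ * b ∈ T := by
    intro a ha b hb h
    obtain ⟨c, rfl⟩ : ∃ c, b = a * c := ⟨a⁻¹ * b, by simp⟩
    have hc : c ∈ A := by simpa using A.mul_mem (A.inv_mem ha) hb
    obtain ⟨t, ht, e⟩ := hcomm a ha c hc
    have e2 : (a⁻¹ * (x⁻¹ * a * x))⁻¹ * ((a * c)⁻¹ * (x⁻¹ * (a * c) * x))
        = t * (c⁻¹ * (x⁻¹ * c * x)) := by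
      calc _ = (a⁻¹ * (x⁻¹ * a * x))⁻¹ * (c⁻¹ * (a⁻¹ * (x⁻¹ * a * x)) * c)
            * (c⁻¹ * (x⁻¹ * c * x)) := by group
        _ = _ := by rw [e]; group
    rw [e2, T.mul_mem_cancel_left ht, hT] at h
    rw [inv_mul_cancel_left, hT]
    refine ⟨hc, ?_⟩
    have h2 := A.mul_mem hc (A.inv_mem h.2)
    have e3 : c * (x * (c⁻¹ * (x⁻¹ * c * x)) * x⁻¹)⁻¹ = x * c * x⁻¹ := by group
    rwa [e3] at h2
  have hcard : Nat.card (T.subgroupOf A) = Nat.card (T.subgroupOf C) := by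
    rw [Nat.card_congr (Subgroup.subgroupOfEquivOfLe hTA).toEquiv,
      Nat.card_congr (Subgroup.subgroupOfEquivOfLe hTC).toEquiv]
  -- Defined on chosen representatives, so well-definedness need not be checked.
  let f : A ⧸ T.subgroupOf A → C ⧸ T.subgroupOf C := fun q =>
    QuotientGroup.mk ⟨_, hy q.out q.out.2⟩
  have hf : Function.Injective f := by
    intro q r h
    rw [← q.out_eq', ← r.out_eq']
    refine QuotientGroup.eq.2 (Subgroup.mem_subgroupOf.2 (key _ q.out.2 _ r.out.2 ?_))
    exact Subgroup.mem_subgroupOf.1 (QuotientGroup.eq.1 h)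
  rw [Subgroup.card_eq_card_quotient_mul_card_subgroup (T.subgroupOf A),
    Subgroup.card_eq_card_quotient_mul_card_subgroup (T.subgroupOf C), hcard]
  exact Nat.mul_le_mul_right _ (Nat.card_le_card_of_injective f hf)

/-- The commutators `[a, x]`, `a ∈ A`, commute with each other. -/
theorem commute_of_normalize_conj [Finite G] {p : ℕ} [Fact p.Prime] (hodd : Odd p)
    {A B T : Subgroup G} (hBp : IsPGroup p B)
    (hA : ∀ a ∈ A, ∀ b ∈ A, a * b = b * a)
    (hB : ∀ u ∈ B, ∀ v ∈ B, ∀ w ∈ B, Commute ⁅u, v⁆ w) (hBA : ∀ u ∈ B, ∀ v ∈ B, ⁅u, v⁆ ∈ A)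
    {x : G} (hxB : x ∈ B) (hy : ∀ a ∈ A, a⁻¹ * (x⁻¹ * a * x) ∈ B)
    (hcomm : ∀ a ∈ A, ∀ b ∈ A, (x⁻¹ * a * x)⁻¹ * b⁻¹ * (x⁻¹ * a * x) * b ∈ T)
    (hTA : ∀ t ∈ T, ∀ a ∈ A, Commute t a) (hTA' : ∀ t ∈ T, ∀ a ∈ A, Commute t (x⁻¹ * a * x))
    (hTB : ∀ a ∈ A, ∀ b ∈ A, (x⁻¹ * a * x)⁻¹ * b⁻¹ * (x⁻¹ * a * x) * b ∈ B)
    {a b : G} (ha : a ∈ A) (hb : b ∈ A) :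
    Commute (a⁻¹ * (x⁻¹ * a * x)) (b⁻¹ * (x⁻¹ * b * x)) := by
  have hTy : ∀ t ∈ T, ∀ a ∈ A, Commute (a⁻¹ * (x⁻¹ * a * x)) t := fun t ht a ha =>
    (((hTA t ht a ha).inv_right).mul_right (hTA' t ht a ha)).symm
  have step : ∀ a ∈ A, ∀ c ∈ A,
      ⁅x, (x⁻¹ * a * x)⁻¹ * c⁻¹ * (x⁻¹ * a * x) * c⁆
        = ⁅c⁻¹ * (x⁻¹ * c * x), a⁻¹ * (x⁻¹ * a * x)⁆ := by
    intro a ha c hc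
    refine commutator_eq_of_conj_invariant (c := c) hB hxB (hy a ha) (hy c hc) (hTB a ha c hc)
      (hA _ (hBA _ hxB _ (hy a ha)) c hc) (by group) ?_ (hTy _ (hcomm a ha c hc) c hc)
    calc c⁻¹ * (a⁻¹ * (x⁻¹ * a * x)) * c = (a * c)⁻¹ * (x⁻¹ * a * x) * c := by group
      _ = (c * a)⁻¹ * (x⁻¹ * a * x) * c := by rw [hA a ha c hc]
      _ = _ := by group
  have h1 := step a ha b hb
  have h2 := step b hb a ha
  have hw := hcomm a ha b hb
  have hv := hcomm b hb a ha
  have hvB := hTB b hb a ha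
  have hwB := hTB a ha b hb
  set w := (x⁻¹ * a * x)⁻¹ * b⁻¹ * (x⁻¹ * a * x) * b with hwdef
  set v := (x⁻¹ * b * x)⁻¹ * a⁻¹ * (x⁻¹ * b * x) * a with hvdef
  set y := a⁻¹ * (x⁻¹ * a * x) with hydef
  set z := b⁻¹ * (x⁻¹ * b * x) with hzdef
  have hyB : y ∈ B := hy a ha
  have hzB : z ∈ B := hy b hb
  -- Both sides equal `(ab)⁻¹ (ab)^x`, because `ab = ba`.
  have hvw : y * z * w = z * y * v := by
    have aux : ∀ a ∈ A, ∀ b ∈ A, a⁻¹ * (x⁻¹ * a * x) * (b⁻¹ * (x⁻¹ * b * x))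
        * ((x⁻¹ * a * x)⁻¹ * b⁻¹ * (x⁻¹ * a * x) * b) = (b * a)⁻¹ * (x⁻¹ * (a * b) * x) := by
      intro a ha b hb
      rw [mul_assoc, (hTy _ (hcomm a ha b hb) b hb).eq]
      group
    rw [hydef, hzdef, hwdef, hvdef, aux a ha b hb, aux b hb a ha, hA a ha b hb]
  have hzy : Commute (z * y) (v * w⁻¹) :=
    ((hTy v hv b hb).mul_right (hTy w hw b hb).inv_right).mul_left
      ((hTy v hv a ha).mul_right (hTy w hw a ha).inv_right)
  have hv' : v = ⁅y, z⁆ * w := by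
    have e1 : y * z = z * y * (v * w⁻¹) := by rw [← mul_assoc (z * y), ← hvw, mul_inv_cancel_right]
    have e2 : ⁅y, z⁆ = y * z * (z * y)⁻¹ := by rw [commutatorElement_def]; group
    rw [e2, e1, hzy.eq]
    group
  have hyz := hB y hyB z hzB
  have h3 : ⁅x, v⁆ = ⁅x, w⁆ := by
    have hxw : ⁅x, w⁆ ∈ B := by
      rw [commutatorElement_def]
      exact B.mul_mem (B.mul_mem (B.mul_mem hxB hwB) (B.inv_mem hxB)) (B.inv_mem hwB)
    rw [hv', commutatorElement_mul_right_eq_mul_conj,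
      commutatorElement_eq_one_iff_commute.2 (hyz x hxB).symm, one_mul, (hyz _ hxw).eq,
      mul_inv_cancel_right]
  -- Since `v` and `w` differ by a central factor, `⁅y, z⁆ = ⁅x, v⁆ = ⁅x, w⁆ = ⁅z, y⁆`. A square
  -- equal to `1` is trivial in a group of odd order.
  have h4 : ⁅y, z⁆ ^ 2 = 1 := by
    rw [pow_two]
    nth_rewrite 1 [← h2]
    rw [h3, h1, ← commutatorElement_inv y z, inv_mul_cancel]
  have h5 : ⁅y, z⁆ ∈ B := by
    rw [commutatorElement_def]
    exact B.mul_mem (B.mul_mem (B.mul_mem hyB hzB) (B.inv_mem hyB)) (B.inv_mem hzB)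
  have h6 := hBp.orderOf_coprime hodd.coprime_two_right ⟨_, h5⟩
  have h7 : orderOf (⟨_, h5⟩ : B) ∣ 2 := orderOf_dvd_of_pow_eq_one (Subtype.ext h4)
  have h8 := orderOf_eq_one_iff.1 (Nat.Coprime.eq_one_of_dvd h6 h7)
  exact commutatorElement_eq_one_iff_commute.1 (congrArg Subtype.val h8)

/-- **Replacement theorem** (Thompson, Glauberman). -/
theorem exists_abelian_replacement [Finite G] {p : ℕ} [Fact p.Prime] (hodd : Odd p)
    {A B : Subgroup G} [B.Normal] (hA : ∀ a ∈ A, ∀ b ∈ A, a * b = b * a)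
    (hAB : IsPGroup p (A ⊔ B : Subgroup G))
    (hB : ∀ u ∈ B, ∀ v ∈ B, ∀ w ∈ B, Commute ⁅u, v⁆ w) (hBA : ∀ u ∈ B, ∀ v ∈ B, ⁅u, v⁆ ∈ A)
    (hn : ¬ B ≤ Subgroup.normalizer (A : Set G)) :
    ∃ C ≤ A ⊔ B, (∀ a ∈ C, ∀ b ∈ C, a * b = b * a) ∧ Nat.card A ≤ Nat.card C ∧
      A ⊓ B < C ⊓ B ∧ C ≤ Subgroup.normalizer (A : Set G) ∧
      ((∀ a ∈ A, a ^ p = 1) → ∀ a ∈ C, a ^ p = 1) := by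
  have hBp : IsPGroup p B := hAB.to_le le_sup_right
  -- choose `x` such that `A` and its conjugate by `x` normalise each other
  obtain ⟨x, hxB, hxA, hx⟩ : ∃ x ∈ B, x ∉ Subgroup.normalizer (A : Set G) ∧
      x ∈ Subgroup.normalizer
        ((Subgroup.normalizer (A : Set G) ⊓ (A ⊔ B) : Subgroup G) : Set G) := by
    have hlt : Subgroup.normalizer (A : Set G) ⊓ (A ⊔ B) < A ⊔ B := by
      refine lt_of_le_of_ne inf_le_right fun h => hn ?_
      exact le_sup_right.trans (inf_eq_right.1 h)
    obtain ⟨g, hg, hgN, hgn⟩ := exists_mem_normalizer_of_lt hAB hlt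
    -- The factor in `A` normalises both `A` and `N_G(A) ⊓ AB`, so it can be dropped from the
    -- element of `AB`.
    obtain ⟨a, ha, b, hb, rfl⟩ := Subgroup.mem_sup_of_normal_right.1 hg
    have haN : a ∈ Subgroup.normalizer (A : Set G) ⊓ (A ⊔ B) :=
      ⟨Subgroup.le_normalizer ha, (le_sup_left : A ≤ A ⊔ B) ha⟩
    refine ⟨b, hb, fun h => hgN ⟨?_, hg⟩, ?_⟩
    · exact Subgroup.mul_mem _ haN.1 h
    · exact (Subgroup.mul_mem_cancel_left _ (Subgroup.le_normalizer haN)).1 hgn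
  set N := Subgroup.normalizer (A : Set G) ⊓ (A ⊔ B) with hN
  let A' : Subgroup G := A.map (MulAut.conj x⁻¹).toMonoidHom
  have hA' : ∀ t, t ∈ A' ↔ x * t * x⁻¹ ∈ A := by
    intro t
    constructor
    · rintro ⟨a, ha, rfl⟩
      simpa [mul_assoc] using ha
    · intro h
      exact ⟨_, h, by simp [mul_assoc]⟩
  have hAN : A ≤ N := le_inf Subgroup.le_normalizer le_sup_left
  have hcA' : ∀ a ∈ A, x⁻¹ * a * x ∈ A' := fun a ha => (hA' _).2 (by simpa [mul_assoc] using ha)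
  -- As `x` normalises `N`, both `A` and `A' = A^x` lie in `N = N^x`, so each normalises the other.
  have hA'N : A' ≤ Subgroup.normalizer (A : Set G) := by
    intro t ht
    have := (Subgroup.mem_normalizer_iff.1 hx t).2 (hAN ((hA' t).1 ht))
    exact this.1
  have hAN' : A ≤ Subgroup.normalizer (A' : Set G) := by
    intro a ha
    have h := (Subgroup.mem_inf.1 ((Subgroup.mem_normalizer_iff.1 hx a).1 (hAN ha))).1
    rw [Subgroup.mem_normalizer_iff] at h ⊢
    intro t
    rw [hA', hA', h]
    have e : x * a * x⁻¹ * (x * t * x⁻¹) * (x * a * x⁻¹)⁻¹ = x * (a * t * a⁻¹) * x⁻¹ := by group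
    rw [e]
  have hA'comm : ∀ a ∈ A', ∀ b ∈ A', a * b = b * a := by
    rintro _ ⟨a, ha, rfl⟩ _ ⟨b, hb, rfl⟩
    rw [← map_mul, hA a ha b hb, map_mul]
  have hcomm : ∀ a ∈ A, ∀ b ∈ A, (x⁻¹ * a * x)⁻¹ * b⁻¹ * (x⁻¹ * a * x) * b ∈ A ⊓ A' :=
    fun a ha b hb => commutator_mem_inf_of_normalize hAN' hA'N hb (hcA' a ha)
  have hTA : ∀ t ∈ A ⊓ A', ∀ a ∈ A, Commute t a := fun t ht a ha => hA t ht.1 a ha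
  have hTA' : ∀ t ∈ A ⊓ A', ∀ a ∈ A, Commute t (x⁻¹ * a * x) := fun t ht a ha =>
    hA'comm t ht.2 _ (hcA' a ha)
  have hyB : ∀ a ∈ A, a⁻¹ * (x⁻¹ * a * x) ∈ B := by
    intro a _
    have := B.mul_mem (Subgroup.Normal.conj_mem ‹_› x⁻¹ (B.inv_mem hxB) a⁻¹) hxB
    simpa [mul_assoc] using this
  have hTB : ∀ a ∈ A, ∀ b ∈ A, (x⁻¹ * a * x)⁻¹ * b⁻¹ * (x⁻¹ * a * x) * b ∈ B := by
    intro a ha b hb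
    have h1 := Subgroup.Normal.conj_mem ‹B.Normal› _ (hyB a ha) b⁻¹
    have h2 := B.mul_mem (B.inv_mem (hyB a ha)) h1
    have e : (a⁻¹ * (x⁻¹ * a * x))⁻¹ * (b⁻¹ * (a⁻¹ * (x⁻¹ * a * x)) * b⁻¹⁻¹)
        = (x⁻¹ * a * x)⁻¹ * (a * b⁻¹ * a⁻¹) * (x⁻¹ * a * x) * b := by group
    rw [e, hA a ha b⁻¹ (A.inv_mem hb), mul_inv_cancel_right] at h2
    exact h2
  have hTy : ∀ t ∈ A ⊓ A', ∀ a ∈ A, Commute (a⁻¹ * (x⁻¹ * a * x)) t := fun t ht a ha =>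
    (((hTA t ht a ha).inv_right).mul_right (hTA' t ht a ha)).symm
  let Y : Set G := {y | ∃ a ∈ A, y = a⁻¹ * (x⁻¹ * a * x)}
  -- The replacement is generated by the commutators `[a, x]` and `A ∩ A^x`; the latter is
  -- centralised by `A` and `A^x`.
  let C : Subgroup G := Subgroup.closure (Y ∪ (A ⊓ A' : Subgroup G))
  have hYC : ∀ a ∈ A, a⁻¹ * (x⁻¹ * a * x) ∈ C := fun a ha =>
    Subgroup.subset_closure (Or.inl ⟨a, ha, rfl⟩)
  have hTC : A ⊓ A' ≤ C := fun t ht => Subgroup.subset_closure (Or.inr ht)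
  have hCcomm : ∀ a ∈ C, ∀ b ∈ C, a * b = b * a := by
    have hgen : ∀ a ∈ Y ∪ (A ⊓ A' : Subgroup G), ∀ b ∈ Y ∪ (A ⊓ A' : Subgroup G),
        a * b = b * a := by
      rintro _ (⟨a, ha, rfl⟩ | ha) _ (⟨b, hb, rfl⟩ | hb)
      · exact commute_of_normalize_conj hodd hBp hA hB hBA hxB hyB hcomm hTA hTA' hTB ha hb
      · exact hTy _ hb a ha
      · exact (hTy _ ha b hb).symm
      · exact hA _ ha.1 _ hb.1
    intro a ha b hb
    have := Subgroup.isMulCommutative_closure hgen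
    have h := this.is_comm.comm (⟨a, ha⟩ : C) ⟨b, hb⟩
    exact congrArg Subtype.val h
  have hCle : ∀ K : Subgroup G, A ≤ K → A' ≤ K → C ≤ K := by
    intro K h1 h2
    refine (Subgroup.closure_le K).2 ?_
    rintro _ (⟨a, ha, rfl⟩ | ha)
    · exact K.mul_mem (K.inv_mem (h1 ha)) (h2 (hcA' a ha))
    · exact h1 ha.1
  have hABT : A ⊓ B ≤ A ⊓ A' := by
    rintro t ⟨htA, htB⟩
    refine ⟨htA, (hA' t).2 ?_⟩
    have := A.mul_mem (hBA x hxB t htB) htA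
    simpa [commutatorElement_def, mul_assoc] using this
  refine ⟨C, ?_, hCcomm, ?_, ?_, hCle _ Subgroup.le_normalizer hA'N, ?_⟩
  · refine hCle _ le_sup_left ?_
    rintro _ ⟨a, ha, rfl⟩
    have hxs : x ∈ A ⊔ B := (le_sup_right : B ≤ A ⊔ B) hxB
    have := Subgroup.mul_mem _ (Subgroup.mul_mem _ (Subgroup.inv_mem _ hxs)
      ((le_sup_left : A ≤ A ⊔ B) ha)) hxs
    simpa using this
  · refine card_le_card_of_conj_quotient (T := A ⊓ A') (x := x) ?_ hTC hYC ?_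
    · intro t
      rw [Subgroup.mem_inf, hA']
    · intro a ha b hb
      refine ⟨_, hcomm a ha b hb, ?_⟩
      calc b⁻¹ * (a⁻¹ * (x⁻¹ * a * x)) * b = (a * b)⁻¹ * (x⁻¹ * a * x) * b := by group
        _ = (b * a)⁻¹ * (x⁻¹ * a * x) * b := by rw [hA a ha b hb]
        _ = _ := by group
  -- If equality held, every `a⁻¹ a^x` would lie in `A`, and `x` would normalise `A`.
  · refine lt_of_le_of_ne (le_inf (hABT.trans hTC) inf_le_right) fun h => hxA ?_
    have hcA : ∀ a ∈ A, x⁻¹ * a * x ∈ A := by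
      intro a ha
      have h1 : a⁻¹ * (x⁻¹ * a * x) ∈ A ⊓ B := h ▸ ⟨hYC a ha, hyB a ha⟩
      simpa using A.mul_mem ha h1.1
    have hle : A' ≤ A := by
      rintro _ ⟨a, ha, rfl⟩
      simpa using hcA a ha
    have heq : A' = A := Subgroup.eq_of_le_of_card_ge hle
      (Nat.card_congr (A.equivMapOfInjective _ (MulAut.conj x⁻¹).injective).toEquiv).le
    rw [Subgroup.mem_normalizer_iff]
    intro t
    rw [← hA', heq]
  · intro hAe
    have hxe : ∀ a ∈ A, (x⁻¹ * a * x) ^ p = 1 := by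
      intro a ha
      have := conj_pow (i := p) (a := x⁻¹) (b := a)
      rw [inv_inv, hAe a ha] at this
      rw [this]
      group
    intro c hc
    have hpow : ∀ y ∈ Y ∪ (A ⊓ A' : Subgroup G), y ^ p = 1 := by
      rintro _ (⟨a, ha, rfl⟩ | ha)
      -- The commutator of `a^x` with `a⁻¹` lies in `A ∩ A^x`, so it commutes with both factors of
      -- `a⁻¹ a^x` and has `p`-th power `1`.
      · have hz := hcomm a ha a⁻¹ (A.inv_mem ha)
        exact mul_pow_prime_eq_one Fact.out hodd (u := x⁻¹ * a * x) (v := a⁻¹) (by group)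
          (hTA' _ hz a ha) (hTA _ hz a ha).inv_right (hxe a ha)
          (by rw [inv_pow, hAe a ha, inv_one]) (hAe _ hz.1)
      · exact hAe _ ha.1
    refine Subgroup.closure_induction (fun y hy => hpow y hy) (one_pow p) ?_ ?_ hc
    · intro u v hu hv hup hvp
      rw [(show Commute u v from hCcomm u hu v hv).mul_pow, hup, hvp, one_mul]
    · intro u _ hup
      rw [inv_pow, hup, inv_one]

end Replacement

/-! ### Normality of the intersection of a replacement family -/

section Normality

variable {G : Type*} [Group G]

theorem pCore_normal (p : ℕ) (G : Type*) [Group G] : (pCore p G).Normal :=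
  Subgroup.sSup_normal _ fun _ h => h.1

theorem isPGroup_pCore (p : ℕ) (G : Type*) [Group G] : IsPGroup p (pCore p G) :=
  Sylow.sSup_of_normal _ (fun _ h => h.2) fun _ h => h.1

theorem le_pCore {p : ℕ} {N : Subgroup G} (hN : N.Normal) (h : IsPGroup p N) : N ≤ pCore p G :=
  le_sSup ⟨hN, h⟩

/-- The part of `p`-stability that concerns a normal `p`-subgroup. -/
theorem exists_normal_of_isPStable [Finite G] {p : ℕ} [Fact p.Prime] (hst : IsPStable p G)
    {B : Subgroup G} [hBn : B.Normal] (hB : IsPGroup p B) :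
    ∃ K : Subgroup G, K.Normal ∧
      (∀ g, commutatorWith (commutatorWith B g) g = ⊥ → g ∈ K) ∧
      (∀ P : Sylow p G, K ≤ (P : Subgroup G) ⊔ Subgroup.centralizer (B : Set G)) ∧
      (IsPGroup p (Subgroup.centralizer (B : Set G)) → IsPGroup p K) := by
  have hN : ∀ g, g ∈ Subgroup.normalizer (B : Set G) := fun g => by
    rw [Subgroup.normalizer_eq_top]; trivial
  let ι : G →* Subgroup.normalizer (B : Set G) := (MonoidHom.id G).codRestrict _ hN
  let C := (Subgroup.centralizer (B : Set G)).subgroupOf (Subgroup.normalizer (B : Set G))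
  let π : G →* Subgroup.normalizer (B : Set G) ⧸ C := (QuotientGroup.mk' C).comp ι
  have hπ : Function.Surjective π := by
    intro q
    obtain ⟨g, rfl⟩ := QuotientGroup.mk'_surjective C q
    exact ⟨g, rfl⟩
  have hker : π.ker = Subgroup.centralizer (B : Set G) := by
    ext g
    rw [MonoidHom.mem_ker]
    exact (QuotientGroup.eq_one_iff (N := C) (ι g)).trans Subgroup.mem_subgroupOf
  have := pCore_normal p (Subgroup.normalizer (B : Set G) ⧸ C)
  -- Here `N_G(B) = G`, and `K` is the preimage of `O_p(G / C_G(B))`, which lies in the image of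
  -- every Sylow subgroup.
  refine ⟨(pCore p _).comap π, inferInstance, fun g hg => hst B hB (ι g) hg, fun P => ?_, fun h => ?_⟩
  · have h1 := (isPGroup_pCore p (Subgroup.normalizer (B : Set G) ⧸ C)).le_sylow_of_normal
      (P.mapSurjective hπ)
    refine (Subgroup.comap_mono h1).trans ?_
    rw [Sylow.coe_mapSurjective, Subgroup.comap_map_eq, hker]
  · exact (isPGroup_pCore p _).comap_of_ker_isPGroup π (hker ▸ h)

theorem commutatorWith_commutatorWith_eq_bot {H A : Subgroup G}
    (hA : ∀ a ∈ A, ∀ b ∈ A, a * b = b * a) {g : G} (hg : g ∈ A)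
    (h : ∀ x ∈ H, x⁻¹ * g⁻¹ * x ∈ A) : commutatorWith (commutatorWith H g) g = ⊥ := by
  have h1 : commutatorWith H g ≤ A := by
    refine (Subgroup.closure_le A).2 ?_
    rintro _ ⟨x, hx, rfl⟩
    exact A.mul_mem (h x hx) hg
  refine Subgroup.closure_eq_bot_iff.2 ?_
  rintro _ ⟨x, hx, rfl⟩
  rw [mul_assoc, hA x (h1 hx) g hg]
  simp

/-- Prepares the Frattini argument for `P ⊓ L`: a Sylow subgroup of `L` is `Q ⊓ L` for some Sylow
`Q` of `G`, and an element conjugating `Q` to `P` preserves `L`. -/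
theorem exists_sylow_map_eq_inf [Finite G] {p : ℕ} [Fact p.Prime] (P : Sylow p G)
    (L : Subgroup G) [L.Normal] : ∃ R : Sylow p L, R.map L.subtype = (P : Subgroup G) ⊓ L := by
  obtain ⟨R⟩ : Nonempty (Sylow p L) := inferInstance
  obtain ⟨Q, hQ⟩ := R.exists_comap_subtype_eq
  obtain ⟨g, rfl⟩ := MulAction.exists_smul_eq G Q P
  refine ⟨(MulAut.conjNormal g : MulAut L) • R, ?_⟩
  ext x
  have key : ∀ y : L, y ∈ (MulAut.conjNormal g : MulAut L) • R ↔ (y : G) ∈ g • Q := by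
    intro y
    have h1 : y ∈ (MulAut.conjNormal g : MulAut L) • R ↔ (MulAut.conjNormal g : MulAut L)⁻¹ • y ∈
        (R : Subgroup L) := Subgroup.mem_pointwise_smul_iff_inv_smul_mem
    have h2 : (y : G) ∈ g • Q ↔ (MulAut.conj g)⁻¹ • (y : G) ∈ (Q : Subgroup G) :=
      Subgroup.mem_pointwise_smul_iff_inv_smul_mem
    rw [h1, h2, ← hQ, Subgroup.mem_comap, ← map_inv, ← map_inv]
    simp [MulAut.smul_def]
  constructor
  · rintro ⟨y, hy, rfl⟩
    exact ⟨(key y).1 hy, y.2⟩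
  · rintro ⟨h1, h2⟩
    exact ⟨⟨x, h2⟩, (key ⟨x, h2⟩).2 h1, rfl⟩

theorem commutator_lt_self [Finite G] {p : ℕ} [Fact p.Prime] {B : Subgroup G}
    (hB : IsPGroup p B) (h : B ≠ ⊥) : ⁅B, B⁆ < B := by
  refine lt_of_le_of_ne (Subgroup.commutator_le_self B) fun he => h ?_
  obtain ⟨n, hn⟩ := (Subgroup.isNilpotent_iff_lowerCentralSeries B).1 hB.isNilpotent
  have h2 : ∀ n, B.lowerCentralSeries n = B := by
    intro n
    induction n with
    | zero => rfl
    | succ n ih => rw [Subgroup.lowerCentralSeries_succ, ih, he]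
  rw [← hn, h2]

/-- `⁅N, B⁆ ≤ M` as soon as this holds for generators of the normal closure `N`. -/
theorem commutator_normalClosure_le {S : Set G} {B M : Subgroup G} [B.Normal] [M.Normal]
    (h : ∀ s ∈ S, ∀ b ∈ B, ⁅s, b⁆ ∈ M) : ⁅Subgroup.normalClosure S, B⁆ ≤ M := by
  -- The elements centralising `B` modulo `M` form a normal subgroup, so containing `S` is enough.
  let C : Subgroup G :=
    (Subgroup.centralizer (B.map (QuotientGroup.mk' M) : Set (G ⧸ M))).comap (QuotientGroup.mk' M)
  have : (B.map (QuotientGroup.mk' M)).Normal :=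
    Subgroup.Normal.map ‹_› _ (QuotientGroup.mk'_surjective M)
  have hC : ∀ x, x ∈ C ↔ ∀ b ∈ B, ⁅x, b⁆ ∈ M := by
    intro x
    have hb : ∀ b, ⁅x, b⁆ ∈ M ↔
        (b : G ⧸ M) * (x : G ⧸ M) = (x : G ⧸ M) * (b : G ⧸ M) := by
      intro b
      rw [← QuotientGroup.eq_one_iff, ← QuotientGroup.mk'_apply M ⁅x, b⁆, map_commutatorElement,
        commutatorElement_eq_one_iff_mul_comm, eq_comm]
      rfl
    simp only [hb]
    constructor
    · intro hx b hbB
      exact Subgroup.mem_centralizer_iff.1 hx _ ⟨b, hbB, rfl⟩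
    · intro hx
      refine Subgroup.mem_centralizer_iff.2 ?_
      rintro _ ⟨b, hbB, rfl⟩
      exact hx b hbB
  have hle : Subgroup.normalClosure S ≤ C :=
    Subgroup.normalClosure_le_normal fun s hs => (hC s).2 (h s hs)
  exact Subgroup.commutator_le.2 fun x hx b hb => (hC x).1 (hle hx) b hb

/-- If a family of subgroups of `D` is closed under those conjugations which do not leave `D`, then
an element normalising `E ≤ D` normalises the intersection of the members of the family inside
`E`. -/
theorem conj_mem_sInf_of_normalize {D E : Subgroup G} {𝒜 : Set (Subgroup G)} (hED : E ≤ D)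
    (hconj : ∀ A ∈ 𝒜, ∀ g : G, A.map (MulAut.conj g).toMonoidHom ≤ D →
      A.map (MulAut.conj g).toMonoidHom ∈ 𝒜) {n : G} (hn : ∀ e ∈ E, n⁻¹ * e * n ∈ E) {z : G}
    (hz : z ∈ sInf {A ∈ 𝒜 | A ≤ E}) : n * z * n⁻¹ ∈ sInf {A ∈ 𝒜 | A ≤ E} := by
  rw [Subgroup.mem_sInf] at hz ⊢
  rintro A ⟨hA, hAE⟩
  have hle : A.map (MulAut.conj n⁻¹).toMonoidHom ≤ E := by
    rintro _ ⟨a, ha, rfl⟩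
    simpa using hn a (hAE ha)
  obtain ⟨a, ha, rfl⟩ := hz _ ⟨hconj A hA n⁻¹ (hle.trans hED), hle⟩
  simpa [mul_assoc] using ha

/-- The properties of a family of abelian subgroups of `D` which make its intersection normal. -/
structure IsReplacementFamily (D : Subgroup G) (𝒜 : Set (Subgroup G)) : Prop where
  nonempty : 𝒜.Nonempty
  le : ∀ A ∈ 𝒜, A ≤ D
  comm : ∀ A ∈ 𝒜, ∀ a ∈ A, ∀ b ∈ A, a * b = b * a
  conj : ∀ A ∈ 𝒜, ∀ g : G, A.map (MulAut.conj g).toMonoidHom ≤ D →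
    A.map (MulAut.conj g).toMonoidHom ∈ 𝒜
  replace : ∀ A ∈ 𝒜, ∀ B : Subgroup G, B.Normal → B ≤ D →
    (∀ u ∈ B, ∀ v ∈ B, ∀ w ∈ B, Commute ⁅u, v⁆ w) → (∀ u ∈ B, ∀ v ∈ B, ⁅u, v⁆ ∈ A) →
    ¬ B ≤ Subgroup.normalizer (A : Set G) →
    ∃ C ∈ 𝒜, A ⊓ B < C ⊓ B ∧ C ≤ Subgroup.normalizer (A : Set G)

theorem mem_normalizer_of_conj_mem [Finite G] {H : Subgroup G} {g : G}
    (h : ∀ x ∈ H, g * x * g⁻¹ ∈ H) : g ∈ Subgroup.normalizer (H : Set G) := by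
  have hle : H.map (MulAut.conj g).toMonoidHom ≤ H := by
    rintro _ ⟨x, hx, rfl⟩
    simpa using h x hx
  have heq := Subgroup.eq_of_le_of_card_ge hle
      (Nat.card_congr (H.equivMapOfInjective _ (MulAut.conj g).injective).toEquiv).le
  refine Subgroup.mem_normalizer_iff.2 fun x => ⟨h x, fun hx => ?_⟩
  rw [← heq] at hx
  obtain ⟨y, hy, e⟩ := hx
  have : y = x := by simpa using e
  exact this ▸ hy

variable [Finite G] {p : ℕ} [Fact p.Prime] {P : Sylow p G} {D : Subgroup G}

theorem inf_sInf_normal (hst : IsPStable p G) (hDP : D ≤ P)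
    (hDc : ∀ d ∈ D, ∀ g : G, g * d * g⁻¹ ∈ P → g * d * g⁻¹ ∈ D) {𝒜 : Set (Subgroup G)}
    (h𝒜 : IsReplacementFamily D 𝒜) (B : Subgroup G) (hBn : B.Normal) (hBp : IsPGroup p B) :
    (sInf 𝒜 ⊓ B).Normal := by
  induction B using WellFoundedLT.induction with
  | ind B ih =>
  set Z := sInf 𝒜 with hZ
  have hZA : ∀ A ∈ 𝒜, Z ≤ A := fun A hA => sInf_le hA
  obtain ⟨A₀, hA₀⟩ := h𝒜.nonempty
  have hZD : Z ≤ D := (hZA A₀ hA₀).trans (h𝒜.le A₀ hA₀)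
  have hZcomm : ∀ x ∈ Z, ∀ y ∈ Z, x * y = y * x := fun x hx y hy =>
    h𝒜.comm A₀ hA₀ x (hZA _ hA₀ hx) y (hZA _ hA₀ hy)
  have hBP : B ≤ P := hBp.le_sylow_of_normal P
  have hDE : {A ∈ 𝒜 | A ≤ D} = 𝒜 := Set.sep_eq_self_iff_mem_true.2 h𝒜.le
  -- Strong closure makes `P` normalise `D`, and hence permute `𝒜`.
  have hPZ : ∀ g ∈ P, ∀ z ∈ Z, g * z * g⁻¹ ∈ Z := by
    intro g hg z hz
    rw [hZ, ← hDE] at hz ⊢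
    refine conj_mem_sInf_of_normalize le_rfl h𝒜.conj (fun d hd => ?_) hz
    have := hDc d hd g⁻¹ (P.mul_mem (P.mul_mem (P.inv_mem hg) (hDP hd))
      (by rw [inv_inv]; exact hg))
    rwa [inv_inv] at this
  by_contra hnot
  -- `B` is the normal closure of `Z ⊓ B`
  have hBcl : Subgroup.normalClosure ((Z ⊓ B : Subgroup G) : Set G) = B := by
    have hle : Subgroup.normalClosure ((Z ⊓ B : Subgroup G) : Set G) ≤ B :=
      Subgroup.normalClosure_le_normal fun x hx => hx.2
    by_contra hne
    have h1 := ih _ (lt_of_le_of_ne hle hne) inferInstance (hBp.to_le hle)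
    have h2 : Z ⊓ Subgroup.normalClosure ((Z ⊓ B : Subgroup G) : Set G) = Z ⊓ B :=
      le_antisymm (inf_le_inf_left _ hle)
        (le_inf inf_le_left fun x hx => Subgroup.subset_normalClosure hx)
    exact hnot (h2 ▸ h1)
  -- Conjugates of elements of `D ⊓ B` stay in `B ≤ P`, hence in `D`; so `D ⊓ B` is normal and
  -- contains `Z ⊓ B`.
  have hBD : B ≤ D := by
    have : (D ⊓ B).Normal := ⟨fun d hd g =>
      ⟨hDc d hd.1 g (hBP (hBn.conj_mem d hd.2 g)), hBn.conj_mem d hd.2 g⟩⟩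
    rw [← hBcl]
    exact (Subgroup.normalClosure_le_normal (N := D ⊓ B) fun x hx => ⟨hZD hx.1, hx.2⟩).trans
      inf_le_left
  have hB0 : B ≠ ⊥ := by
    rintro rfl
    exact hnot (by rw [inf_bot_eq]; infer_instance)
  -- the commutators of `B` lie in `Z` and are central in `B`
  have hBZ : ⁅B, B⁆ ≤ Z := by
    -- By minimality `Z ⊓ ⁅B, B⁆` is normal. It contains `⁅Z ⊓ B, B⁆` because `P` normalises `Z`,
    -- and so contains `⁅B, B⁆`.
    have h1 := ih _ (commutator_lt_self hBp hB0) inferInstance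
      (hBp.to_le (Subgroup.commutator_le_self B))
    have h2 := commutator_normalClosure_le (S := ((Z ⊓ B : Subgroup G) : Set G)) (B := B)
      (M := Z ⊓ ⁅B, B⁆) (fun z hz b hb => by
        refine ⟨?_, Subgroup.commutator_mem_commutator hz.2 hb⟩
        have := Z.mul_mem hz.1 (hPZ b (hBP hb) z⁻¹ (Z.inv_mem hz.1))
        simpa [commutatorElement_def, mul_assoc] using this)
    rw [hBcl] at h2
    exact h2.trans inf_le_left
  have hBcent : ∀ u ∈ B, ∀ v ∈ B, ∀ w ∈ B, Commute ⁅u, v⁆ w := by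
    -- The centraliser of `⁅B, B⁆` is normal and contains `Z ⊓ B`, since `⁅B, B⁆ ≤ Z` and `Z` is
    -- abelian.
    have h1 : B ≤ Subgroup.centralizer ((⁅B, B⁆ : Subgroup G) : Set G) := by
      conv_lhs => rw [← hBcl]
      refine Subgroup.normalClosure_le_normal fun z hz => ?_
      exact Subgroup.mem_centralizer_iff.2 fun c hc => hZcomm c (hBZ hc) z hz.1
    intro u hu v hv w hw
    exact Subgroup.mem_centralizer_iff.1 (h1 hw) _ (Subgroup.commutator_mem_commutator hu hv)
  set L := (Subgroup.normalizer ((Z ⊓ B : Subgroup G) : Set G)).normalCore with hL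
  have hLN : L ≤ Subgroup.normalizer ((Z ⊓ B : Subgroup G) : Set G) := Subgroup.normalCore_le _
  have hfrat : Subgroup.normalizer (((P : Subgroup G) ⊓ L : Subgroup G) : Set G) ⊔ L = ⊤ := by
    obtain ⟨R, hR⟩ := exists_sylow_map_eq_inf P L
    rw [← hR]
    exact Sylow.normalizer_sup_eq_top R
  have hnE : ∀ n ∈ Subgroup.normalizer (((P : Subgroup G) ⊓ L : Subgroup G) : Set G),
      ∀ e ∈ D ⊓ L, n⁻¹ * e * n ∈ D ⊓ L := by
    intro n hn e he
    have h1 := (Subgroup.mem_normalizer_iff.1 (Subgroup.inv_mem _ hn) e).1 ⟨hDP he.1, he.2⟩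
    have h2 := hDc e he.1 n⁻¹ h1.1
    rw [inv_inv] at h1 h2
    exact ⟨h2, h1.2⟩
  by_cases hall : ∀ A ∈ 𝒜, A ≤ L
  · have hE : {A ∈ 𝒜 | A ≤ D ⊓ L} = 𝒜 :=
      Set.sep_eq_self_iff_mem_true.2 fun A hA => le_inf (h𝒜.le A hA) (hall A hA)
    have h1 : Subgroup.normalizer (((P : Subgroup G) ⊓ L : Subgroup G) : Set G) ≤
        Subgroup.normalizer ((Z ⊓ B : Subgroup G) : Set G) := by
      intro n hn
      refine mem_normalizer_of_conj_mem fun z hz => ⟨?_, hBn.conj_mem z hz.2 n⟩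
      have hz1 := hz.1
      rw [hZ, ← hE] at hz1 ⊢
      exact conj_mem_sInf_of_normalize inf_le_left h𝒜.conj (hnE n hn) hz1
    exact hnot (Subgroup.normalizer_eq_top_iff.1 (top_le_iff.1 (hfrat ▸ sup_le h1 hLN)))
  · push Not at hall
    obtain ⟨A, ⟨hA, hAL⟩, hmax⟩ := Set.exists_max_image {A ∈ 𝒜 | ¬ A ≤ L}
      (fun A => Nat.card (A ⊓ B : Subgroup G)) (Set.toFinite _) hall
    have hBA : B ≤ Subgroup.normalizer (A : Set G) := by
      by_contra hBA
      obtain ⟨C, hC, hlt, hCA⟩ := h𝒜.replace A hA B hBn hBD hBcent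
        (fun u hu v hv => hZA A hA (hBZ (Subgroup.commutator_mem_commutator hu hv))) hBA
      -- Otherwise `C` would contradict the maximal choice of `A ⊓ B`.
      have hCL : C ≤ L := by
        by_contra hCL
        exact hlt.ne (Subgroup.eq_of_le_of_card_ge hlt.le (hmax C ⟨hC, hCL⟩))
      refine hBA (le_trans ?_ hCA)
      -- The members inside `D ⊓ L` have an intersection containing `Z` and preserved by `N_G(P ⊓
      -- L)`. Writing `g = n l`, the factor `l ∈ L` preserves `Z ⊓ B`, so all conjugates of `Z ⊓ B`
      -- lie in that intersection.
      refine le_trans ?_ (sInf_le ⟨hC, le_inf (h𝒜.le C hC) hCL⟩ : sInf {A ∈ 𝒜 | A ≤ D ⊓ L} ≤ C)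
      conv_lhs => rw [← hBcl]
      refine (Subgroup.closure_le _).2 fun y hy => ?_
      obtain ⟨z, hz, hzy⟩ := Group.mem_conjugatesOfSet_iff.1 hy
      obtain ⟨g, rfl⟩ := isConj_iff.1 hzy
      have hg : g ∈ Subgroup.normalizer (((P : Subgroup G) ⊓ L : Subgroup G) : Set G) ⊔ L :=
        hfrat ▸ Subgroup.mem_top g
      obtain ⟨n, hn, l, hl, rfl⟩ := Subgroup.mem_sup_of_normal_right.1 hg
      have h1 := (Subgroup.mem_normalizer_iff.1 (hLN hl) z).1 hz
      have h2 : l * z * l⁻¹ ∈ sInf {A ∈ 𝒜 | A ≤ D ⊓ L} :=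
        (sInf_le_sInf (fun A hA => hA.1) : sInf 𝒜 ≤ sInf {A ∈ 𝒜 | A ≤ D ⊓ L}) h1.1
      have h3 := conj_mem_sInf_of_normalize inf_le_left h𝒜.conj (hnE n hn) h2
      simpa [mul_assoc] using h3
    obtain ⟨K, hKn, hK1, hK2, -⟩ := exists_normal_of_isPStable hst hBp
    refine hAL fun a ha => ?_
    -- `K` is normal and lies in `P C_G(B)`, both factors of which normalise `Z ⊓ B`.
    have hKL : K ≤ L := by
      refine Subgroup.normal_le_normalCore.2 ((hK2 P).trans (sup_le ?_ ?_))
      · exact fun g hg => mem_normalizer_of_conj_mem fun z hz =>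
          ⟨hPZ g hg z hz.1, hBn.conj_mem z hz.2 g⟩
      · refine fun g hg => mem_normalizer_of_conj_mem fun z hz => ?_
        rw [← Subgroup.mem_centralizer_iff.1 hg z hz.2, mul_inv_cancel_right]
        exact hz
    refine hKL (hK1 a (commutatorWith_commutatorWith_eq_bot (h𝒜.comm A hA) ha fun x hx => ?_))
    have := (Subgroup.mem_normalizer_iff.1 (hBA (B.inv_mem hx)) a⁻¹).1 (A.inv_mem ha)
    simpa using this

theorem sInf_normal_of_isReplacementFamily (hst : IsPStable p G)
    (hcent : Subgroup.centralizer (pCore p G : Set G) ≤ pCore p G)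
    (hD : IsStronglyClosed (P : Subgroup G) (D : Set G)) {𝒜 : Set (Subgroup G)}
    (h𝒜 : IsReplacementFamily D 𝒜) : (sInf 𝒜).Normal := by
  have hDP : D ≤ P := hD.2.1
  have hDc : ∀ d ∈ D, ∀ g : G, g * d * g⁻¹ ∈ P → g * d * g⁻¹ ∈ D := by
    intro d hd g hg
    have := hD.2.2 {d} (by simpa using hd) g⁻¹ (by simpa using hg)
    simpa using this
  have hOn := pCore_normal p G
  have hOp := isPGroup_pCore p G
  have hn := inf_sInf_normal hst hDP hDc h𝒜 (pCore p G) hOn hOp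
  obtain ⟨K, hKn, hK1, -, hK2⟩ := exists_normal_of_isPStable hst hOp
  -- `C_G(O_p(G))` is a `p`-group, so `K` is a normal `p`-subgroup. It contains `Z`, since `O_p(G) ≤
  -- P` normalises the abelian group `Z`.
  have hKO : K ≤ pCore p G := le_pCore hKn (hK2 (hOp.to_le hcent))
  obtain ⟨A₀, hA₀⟩ := h𝒜.nonempty
  have hZA : sInf 𝒜 ≤ A₀ := sInf_le hA₀
  have hDE : {A ∈ 𝒜 | A ≤ D} = 𝒜 := Set.sep_eq_self_iff_mem_true.2 h𝒜.le
  have hle : sInf 𝒜 ≤ pCore p G := by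
    refine fun z hz => hKO (hK1 z (commutatorWith_commutatorWith_eq_bot (A := sInf 𝒜)
      (fun a ha b hb => h𝒜.comm A₀ hA₀ a (hZA ha) b (hZA hb)) hz fun x hx => ?_))
    have hxP : x ∈ P := hOp.le_sylow_of_normal P hx
    have hz' := Subgroup.inv_mem _ hz
    rw [← hDE] at hz' ⊢
    have := conj_mem_sInf_of_normalize le_rfl h𝒜.conj (n := x⁻¹) (fun d hd => by
      have h1 := P.mul_mem (P.mul_mem hxP (hDP hd)) (P.inv_mem hxP)
      rw [inv_inv]
      exact hDc d hd x h1) hz'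
    rwa [inv_inv] at this
  rwa [inf_eq_left.2 hle] at hn

end Normality

/-! ### Rank of finite abelian `p`-groups -/

section Rank

/-- A group of exponent dividing `p` is an `𝔽_p`-space whose subgroups are its subspaces, so its
rank is its dimension. -/
theorem card_eq_pow_rank_of_pow_eq_one {p : ℕ} [Fact p.Prime] {V : Type*} [CommGroup V] [Finite V]
    (hV : ∀ v : V, v ^ p = 1) : Nat.card V = p ^ Group.rank V := by
  let : Module (ZMod p) (Additive V) := AddCommGroup.zmodModule (n := p) hV
  have hcard : Nat.card V = p ^ Module.finrank (ZMod p) (Additive V) := by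
    have := Module.natCard_eq_pow_finrank (K := ZMod p) (V := Additive V)
    rwa [Nat.card_zmod] at this
  have h1 : Module.finrank (ZMod p) (Additive V) ≤ Group.rank V := by
    obtain ⟨S, hS, hcl⟩ := Group.rank_spec V
    rw [← hS]
    let T : Finset (Additive V) := S.map Additive.ofMul.toEmbedding
    have hT : Submodule.span (ZMod p) (T : Set (Additive V)) = ⊤ := by
      rw [eq_top_iff]
      intro v _
      have hv : v.toMul ∈ Subgroup.closure (S : Set V) := hcl ▸ Subgroup.mem_top _
      have key : ∀ w ∈ Subgroup.closure (S : Set V),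
          Additive.ofMul w ∈ Submodule.span (ZMod p) (T : Set (Additive V)) := by
        intro w hw
        induction hw using Subgroup.closure_induction with
        | mem x hx => exact Submodule.subset_span (by simpa [T] using hx)
        | one => exact Submodule.zero_mem _
        | mul x y _ _ hx hy => exact Submodule.add_mem _ hx hy
        | inv x _ hx => exact Submodule.neg_mem _ hx
      exact key _ hv
    have := finrank_span_finset_le_card (R := ZMod p) T
    rw [Set.finrank, hT, finrank_top, Finset.card_map] at this
    exact this
  have h2 : Group.rank V ≤ Module.finrank (ZMod p) (Additive V) := by
    classical
    let b := Module.finBasis (ZMod p) (Additive V)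
    let S : Finset V := Finset.univ.image fun i => (b i).toMul
    have hS : Subgroup.closure (S : Set V) = ⊤ := by
      rw [eq_top_iff]
      intro v _
      have hv : Additive.ofMul v ∈ Submodule.span (ZMod p) (Set.range b) :=
        b.span_eq ▸ Submodule.mem_top
      have key : ∀ w ∈ Submodule.span (ZMod p) (Set.range b),
          w.toMul ∈ Subgroup.closure (S : Set V) := by
        intro w hw
        induction hw using Submodule.span_induction with
        | mem x hx =>
          obtain ⟨i, rfl⟩ := hx
          exact Subgroup.subset_closure (by simp [S])
        | zero => exact Subgroup.one_mem _
        | add x y _ _ hx hy => exact Subgroup.mul_mem _ hx hy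
        | smul a x _ hx =>
          obtain ⟨n, rfl⟩ := ZMod.natCast_zmod_surjective a
          rw [Nat.cast_smul_eq_nsmul]
          exact Subgroup.pow_mem _ hx n
      exact key _ hv
    refine (Group.rank_le hS).trans (Finset.card_image_le.trans ?_)
    simp
  rw [hcard, le_antisymm h1 h2]

/-- The `p`-th powers of a finite abelian `p`-group are non-generators. -/
theorem eq_top_of_sup_range_powMonoidHom_eq_top {p : ℕ} [Fact p.Prime] {A : Type*} [CommGroup A]
    [Finite A] (hA : IsPGroup p A) {H : Subgroup A} (h : H ⊔ (powMonoidHom p : A →* A).range = ⊤) :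
    H = ⊤ := by
  -- On the finite quotient `A/H` the `p`-th power map is onto, hence injective, which forces a
  -- `p`-group to be trivial.
  have hsurj : Function.Surjective (fun q : A ⧸ H => q ^ p) := by
    intro q
    obtain ⟨a, rfl⟩ := QuotientGroup.mk_surjective q
    have ha : a ∈ H ⊔ (powMonoidHom p : A →* A).range := h ▸ Subgroup.mem_top a
    obtain ⟨b, hb, _, ⟨c, rfl⟩, rfl⟩ := Subgroup.mem_sup.1 ha
    refine ⟨c, ?_⟩
    have : (b : A ⧸ H) = 1 := (QuotientGroup.eq_one_iff b).2 hb
    simp [this]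
  have hinj := Finite.injective_iff_surjective.2 hsurj
  have hone : ∀ q : A ⧸ H, q = 1 := by
    intro q
    obtain ⟨k, hk⟩ := (hA.to_quotient H) q
    induction k with
    | zero => simpa using hk
    | succ k ih =>
      refine ih (hinj ?_)
      change (q ^ p ^ k) ^ p = 1 ^ p
      rw [← pow_mul, ← pow_succ, hk, one_pow]
  rw [eq_top_iff]
  exact fun a _ => (QuotientGroup.eq_one_iff a).1 (hone a)

/-- Kernel and cokernel of the `p`-th power map have equal order, and `A/A^p` has the same rank as
`A` because generators of `A/A^p` lift to generators of `A`. -/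
theorem card_ker_powMonoidHom_eq_pow_rank {p : ℕ} [Fact p.Prime] {A : Type*} [CommGroup A]
    [Finite A] (hA : IsPGroup p A) :
    Nat.card (powMonoidHom p : A →* A).ker = p ^ Group.rank A := by
  set φ := (powMonoidHom p : A →* A) with hφ
  have hV : ∀ v : A ⧸ φ.range, v ^ p = 1 := by
    intro v
    obtain ⟨a, rfl⟩ := QuotientGroup.mk_surjective v
    exact (QuotientGroup.eq_one_iff (a ^ p)).2 ⟨a, rfl⟩
  have hcard : Nat.card φ.ker = Nat.card (A ⧸ φ.range) := by
    have h1 := Subgroup.card_eq_card_quotient_mul_card_subgroup φ.range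
    have h2 := Subgroup.card_eq_card_quotient_mul_card_subgroup φ.ker
    rw [Nat.card_congr (QuotientGroup.quotientKerEquivRange φ).toEquiv, h1, mul_comm] at h2
    exact (Nat.eq_of_mul_eq_mul_left Nat.card_pos h2).symm
  rw [hcard, card_eq_pow_rank_of_pow_eq_one hV]
  congr 1
  refine le_antisymm
    (Group.rank_le_of_surjective (QuotientGroup.mk' φ.range) (QuotientGroup.mk'_surjective _)) ?_
  classical
  obtain ⟨S, hS, hcl⟩ := Group.rank_spec (A ⧸ φ.range)
  have htop : Subgroup.closure ((S.image Quotient.out : Finset A) : Set A) = ⊤ := by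
    refine eq_top_of_sup_range_powMonoidHom_eq_top hA ?_
    have h1 : (Subgroup.closure ((S.image Quotient.out : Finset A) : Set A)).map
        (QuotientGroup.mk' φ.range) = ⊤ := by
      rw [eq_top_iff, ← hcl, Subgroup.closure_le]
      intro q hq
      refine ⟨q.out, Subgroup.subset_closure ?_, q.out_eq'⟩
      exact Finset.mem_coe.2 (Finset.mem_image_of_mem _ hq)
    have h2 := congrArg (Subgroup.comap (QuotientGroup.mk' φ.range)) h1
    rwa [Subgroup.comap_map_eq, QuotientGroup.ker_mk', Subgroup.comap_top] at h2
  rw [← hS]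
  exact (Group.rank_le htop).trans Finset.card_image_le

variable {G : Type*} [Group G] [Finite G]

theorem exists_elemAbelian_card_eq_pow_rank {p : ℕ} [Fact p.Prime] {A : Subgroup G}
    (hA : IsPGroup p A) (hcomm : ∀ a ∈ A, ∀ b ∈ A, a * b = b * a) :
    ∃ E ≤ A, (∀ x ∈ E, x ^ p = 1) ∧ (∀ x ∈ A, x ^ p = 1 → x ∈ E) ∧
      Nat.card E = p ^ Group.rank A := by
  let : CommGroup A :=
    { (inferInstance : Group A) with mul_comm := fun a b => Subtype.ext (hcomm a a.2 b b.2) }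
  refine ⟨(powMonoidHom p : A →* A).ker.map A.subtype, Subgroup.map_subtype_le _, ?_, ?_, ?_⟩
  · rintro _ ⟨x, hx, rfl⟩
    exact congrArg Subtype.val (MonoidHom.mem_ker.1 hx)
  · intro x hx hxp
    exact ⟨⟨x, hx⟩, MonoidHom.mem_ker.2 (Subtype.ext hxp), rfl⟩
  · rw [← card_ker_powMonoidHom_eq_pow_rank hA]
    exact (Nat.card_congr
      (Subgroup.equivMapOfInjective _ A.subtype A.subtype_injective).toEquiv).symm

theorem card_eq_pow_rank_of_elemAbelian {p : ℕ} [Fact p.Prime] {A : Subgroup G}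
    (hA : IsPGroup p A) (hcomm : ∀ a ∈ A, ∀ b ∈ A, a * b = b * a) (hexp : ∀ a ∈ A, a ^ p = 1) :
    Nat.card A = p ^ Group.rank A := by
  obtain ⟨E, hEA, -, hE, hcard⟩ := exists_elemAbelian_card_eq_pow_rank hA hcomm
  rwa [le_antisymm hEA fun a ha => hE a ha (hexp a ha)] at hcard

end Rank

/-! ### The three Thompson subgroups as intersections and replacement families -/

section Families

variable {G : Type*} [Group G]

theorem mem_centerOf {H : Subgroup G} {x : G} :
    x ∈ centerOf H ↔ x ∈ H ∧ ∀ y ∈ H, x * y = y * x := by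
  constructor
  · rintro ⟨z, hz, rfl⟩
    exact ⟨z.2, fun y hy => congrArg Subtype.val (Subgroup.mem_center_iff.1 hz ⟨y, hy⟩).symm⟩
  · rintro ⟨hx, h⟩
    exact ⟨⟨x, hx⟩, Subgroup.mem_center_iff.2 fun y => Subtype.ext (h y y.2).symm, rfl⟩

theorem mem_centerOf_sSup {𝒜 : Set (Subgroup G)} {x : G} (hx : x ∈ sSup 𝒜)
    (h : ∀ A ∈ 𝒜, ∀ a ∈ A, x * a = a * x) : x ∈ centerOf (sSup 𝒜) := by
  refine mem_centerOf.2 ⟨hx, fun y hy => ?_⟩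
  have hle : sSup 𝒜 ≤ Subgroup.centralizer {x} := sSup_le fun A hA a ha =>
    Subgroup.mem_centralizer_singleton_iff.2 (h A hA a ha).symm
  exact (Subgroup.mem_centralizer_singleton_iff.1 (hle hy)).symm

/-- Adjoining to an abelian subgroup an element which centralises it. -/
theorem exists_abelian_insert {A D : Subgroup G} (hA : A ∈ abelianSubgroups D) {x : G}
    (hxD : x ∈ D) (hx : ∀ a ∈ A, x * a = a * x) :
    ∃ C ∈ abelianSubgroups D, A ≤ C ∧ x ∈ C ∧
      ∀ p : ℕ, (∀ a ∈ A, a ^ p = 1) → x ^ p = 1 → ∀ c ∈ C, c ^ p = 1 := by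
  let C := Subgroup.closure (insert x (A : Set G))
  have hgen : ∀ a ∈ insert x (A : Set G), ∀ b ∈ insert x (A : Set G), a * b = b * a := by
    rintro a (rfl | ha) b (rfl | hb)
    · rfl
    · exact hx b hb
    · exact (hx a ha).symm
    · exact hA.2 a ha b hb
  have hC : ∀ a ∈ C, ∀ b ∈ C, a * b = b * a := fun a ha b hb =>
    congrArg Subtype.val
      ((Subgroup.isMulCommutative_closure hgen).is_comm.comm (⟨a, ha⟩ : C) ⟨b, hb⟩)
  refine ⟨C, ⟨(Subgroup.closure_le D).2 (Set.insert_subset hxD hA.1), hC⟩,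
    fun a ha => Subgroup.subset_closure (Or.inr ha), Subgroup.subset_closure (Or.inl rfl), ?_⟩
  intro p hAp hxp c hc
  refine Subgroup.closure_induction ?_ (one_pow p) ?_ ?_ hc
  · rintro y (rfl | hy)
    exacts [hxp, hAp y hy]
  · intro u v hu hv hup hvp
    rw [(show Commute u v from hC u hu v hv).mul_pow, hup, hvp, one_mul]
  · intro u _ hup
    rw [inv_pow, hup, inv_one]

theorem map_conj_mem_abelianSubgroups {A D : Subgroup G} (hA : A ∈ abelianSubgroups D) {g : G}
    (hg : A.map (MulAut.conj g).toMonoidHom ≤ D) :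
    A.map (MulAut.conj g).toMonoidHom ∈ abelianSubgroups D := by
  refine ⟨hg, ?_⟩
  rintro _ ⟨a, ha, rfl⟩ _ ⟨b, hb, rfl⟩
  rw [← map_mul, hA.2 a ha b hb, map_mul]

theorem card_map_conj (A : Subgroup G) (g : G) :
    Nat.card (A.map (MulAut.conj g).toMonoidHom) = Nat.card A :=
  (Nat.card_congr (A.equivMapOfInjective _ (MulAut.conj g).injective).toEquiv).symm

theorem mem_maxOrderAbelian_iff {A D : Subgroup G} : A ∈ maxOrderAbelian D ↔
    A ∈ abelianSubgroups D ∧ ∀ B ∈ abelianSubgroups D, Nat.card B ≤ Nat.card A := by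
  refine and_congr_right fun hA => ⟨fun h B hB => h.2 ⟨B, hB, rfl⟩, fun h => ⟨⟨A, hA, rfl⟩, ?_⟩⟩
  rintro _ ⟨B, hB, rfl⟩
  exact h B hB

theorem mem_maxOrderElemAbelian_iff {p : ℕ} {A D : Subgroup G} : A ∈ maxOrderElemAbelian p D ↔
    A ∈ elemAbelianSubgroups p D ∧
      ∀ B ∈ elemAbelianSubgroups p D, Nat.card B ≤ Nat.card A := by
  refine and_congr_right fun hA => ⟨fun h B hB => h.2 ⟨B, hB, rfl⟩, fun h => ⟨⟨A, hA, rfl⟩, ?_⟩⟩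
  rintro _ ⟨B, hB, rfl⟩
  exact h B hB

theorem bot_mem_abelianSubgroups (D : Subgroup G) : ⊥ ∈ abelianSubgroups D :=
  ⟨bot_le, fun x hx y hy => by rw [Subgroup.mem_bot.1 hx, Subgroup.mem_bot.1 hy]⟩

variable [Finite G]

theorem mem_maxRankAbelian_iff {A D : Subgroup G} : A ∈ maxRankAbelian D ↔
    A ∈ abelianSubgroups D ∧ ∀ B ∈ abelianSubgroups D, Group.rank B ≤ Group.rank A := by
  refine and_congr_right fun hA => ⟨fun h B hB => h.2 ⟨B, hB, rfl⟩, fun h => ⟨⟨A, hA, rfl⟩, ?_⟩⟩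
  rintro _ ⟨B, hB, rfl⟩
  exact h B hB

theorem maxOrderAbelian_nonempty (D : Subgroup G) : (maxOrderAbelian D).Nonempty := by
  obtain ⟨A, hA, hmax⟩ := Set.exists_max_image (abelianSubgroups D)
    (fun A => Nat.card A) (Set.toFinite _) ⟨⊥, bot_mem_abelianSubgroups D⟩
  exact ⟨A, mem_maxOrderAbelian_iff.2 ⟨hA, hmax⟩⟩

theorem maxOrderElemAbelian_nonempty (p : ℕ) (D : Subgroup G) :
    (maxOrderElemAbelian p D).Nonempty := by
  obtain ⟨A, hA, hmax⟩ := Set.exists_max_image (elemAbelianSubgroups p D)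
    (fun A => Nat.card A) (Set.toFinite _)
    ⟨⊥, bot_mem_abelianSubgroups D, fun x hx => by rw [Subgroup.mem_bot.1 hx, one_pow]⟩
  exact ⟨A, mem_maxOrderElemAbelian_iff.2 ⟨hA, hmax⟩⟩

theorem mem_of_mem_maxOrderElemAbelian {p : ℕ} {A D : Subgroup G}
    (hA : A ∈ maxOrderElemAbelian p D) {x : G} (hxD : x ∈ D) (hxp : x ^ p = 1)
    (hx : ∀ a ∈ A, x * a = a * x) : x ∈ A := by
  rw [mem_maxOrderElemAbelian_iff] at hA
  obtain ⟨C, hC, hAC, hxC, hexp⟩ := exists_abelian_insert hA.1.1 hxD hx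
  have := hA.2 C ⟨hC, hexp p hA.1.2 hxp⟩
  rwa [Subgroup.eq_of_le_of_card_ge hAC this]

/-- A central element of `J_o(D)` centralises each maximal `A`, so adjoining it cannot enlarge `A`;
conversely an element of every `A` commutes with all the generators. -/
theorem centerOf_thompsonO_eq_sInf (D : Subgroup G) :
    centerOf (thompsonO D) = sInf (maxOrderAbelian D) := by
  apply le_antisymm
  · refine le_sInf fun A hA x hx => ?_
    have hAJ : A ≤ thompsonO D := le_sSup hA
    rw [mem_centerOf] at hx
    have hxD : x ∈ D := (sSup_le fun B hB => hB.1.1 : thompsonO D ≤ D) hx.1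
    rw [mem_maxOrderAbelian_iff] at hA
    obtain ⟨C, hC, hAC, hxC, -⟩ := exists_abelian_insert hA.1 hxD fun a ha => hx.2 a (hAJ ha)
    rwa [Subgroup.eq_of_le_of_card_ge hAC (hA.2 C hC)]
  · obtain ⟨A₀, hA₀⟩ := maxOrderAbelian_nonempty D
    intro x hx
    rw [Subgroup.mem_sInf] at hx
    exact mem_centerOf_sSup ((le_sSup hA₀ : A₀ ≤ _) (hx A₀ hA₀)) fun A hA a ha =>
      hA.1.2 x (hx A hA) a ha

theorem omega_centerOf_thompsonE_eq_sInf (p : ℕ) (D : Subgroup G) :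
    omega p (centerOf (thompsonE p D)) = sInf (maxOrderElemAbelian p D) := by
  apply le_antisymm
  · refine le_sInf fun A hA => (Subgroup.closure_le A).2 ?_
    rintro x ⟨hx, hxp⟩
    rw [mem_centerOf] at hx
    have hxD : x ∈ D := (sSup_le fun B hB => hB.1.1.1 : thompsonE p D ≤ D) hx.1
    exact mem_of_mem_maxOrderElemAbelian hA hxD hxp fun a ha =>
      hx.2 a ((le_sSup hA : A ≤ thompsonE p D) ha)
  · obtain ⟨A₀, hA₀⟩ := maxOrderElemAbelian_nonempty p D
    intro x hx
    rw [Subgroup.mem_sInf] at hx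
    exact Subgroup.subset_closure ⟨mem_centerOf_sSup ((le_sSup hA₀ : A₀ ≤ _) (hx A₀ hA₀))
      fun A hA a ha => hA.1.1.2 x (hx A hA) a ha, hA₀.1.2 x (hx A₀ hA₀)⟩

/-- An abelian `p`-group of rank `r` has exactly `p ^ r` elements with `x ^ p = 1`, so comparing
ranks amounts to comparing orders of elementary abelian subgroups. -/
theorem maxOrderElemAbelian_subset_maxRankAbelian {p : ℕ} [Fact p.Prime] {D : Subgroup G}
    (hD : IsPGroup p D) : maxOrderElemAbelian p D ⊆ maxRankAbelian D := by
  intro A hA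
  rw [mem_maxOrderElemAbelian_iff] at hA
  refine mem_maxRankAbelian_iff.2 ⟨hA.1.1, fun B hB => ?_⟩
  obtain ⟨E, hEB, hE, -, hcard⟩ := exists_elemAbelian_card_eq_pow_rank (hD.to_le hB.1) hB.2
  have h1 := hA.2 E ⟨⟨hEB.trans hB.1, fun x hx y hy => hB.2 x (hEB hx) y (hEB hy)⟩, hE⟩
  rw [hcard, card_eq_pow_rank_of_elemAbelian (hD.to_le hA.1.1.1) hA.1.1.2 hA.1.2] at h1
  exact (Nat.pow_le_pow_iff_right (Fact.out : p.Prime).one_lt).1 h1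

theorem exists_le_mem_maxOrderElemAbelian {p : ℕ} [Fact p.Prime] {A D : Subgroup G}
    (hD : IsPGroup p D) (hA : A ∈ maxRankAbelian D) : ∃ E ∈ maxOrderElemAbelian p D, E ≤ A := by
  rw [mem_maxRankAbelian_iff] at hA
  obtain ⟨E, hEA, hE, -, hcard⟩ := exists_elemAbelian_card_eq_pow_rank (hD.to_le hA.1.1) hA.1.2
  refine ⟨E, mem_maxOrderElemAbelian_iff.2
    ⟨⟨⟨hEA.trans hA.1.1, fun x hx y hy => hA.1.2 x (hEA hx) y (hEA hy)⟩, hE⟩, fun B hB => ?_⟩, hEA⟩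
  rw [hcard, card_eq_pow_rank_of_elemAbelian (hD.to_le hB.1.1) hB.1.2 hB.2]
  exact Nat.pow_le_pow_right (Fact.out : p.Prime).pos (hA.2 B hB.1)

/-- Reduces `J_r` to the family for `J_e`: members of that family have maximal rank, and every
abelian subgroup of maximal rank contains one of them. -/
theorem omega_centerOf_thompsonR_eq_sInf {p : ℕ} [Fact p.Prime] {D : Subgroup G}
    (hD : IsPGroup p D) :
    omega p (centerOf (thompsonR D)) = sInf (maxOrderElemAbelian p D) := by
  have hsub := maxOrderElemAbelian_subset_maxRankAbelian hD
  apply le_antisymm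
  · refine le_sInf fun A hA => (Subgroup.closure_le A).2 ?_
    rintro x ⟨hx, hxp⟩
    rw [mem_centerOf] at hx
    have hxD : x ∈ D := (sSup_le fun B hB => hB.1.1 : thompsonR D ≤ D) hx.1
    exact mem_of_mem_maxOrderElemAbelian hA hxD hxp fun a ha =>
      hx.2 a ((le_sSup (hsub hA) : A ≤ thompsonR D) ha)
  · obtain ⟨A₀, hA₀⟩ := maxOrderElemAbelian_nonempty p D
    intro x hx
    rw [Subgroup.mem_sInf] at hx
    refine Subgroup.subset_closure
      ⟨mem_centerOf_sSup ((le_sSup (hsub hA₀) : A₀ ≤ _) (hx A₀ hA₀)) fun A hA a ha => ?_,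
        hA₀.1.2 x (hx A₀ hA₀)⟩
    obtain ⟨E, hE, hEA⟩ := exists_le_mem_maxOrderElemAbelian hD hA
    exact hA.1.2 x (hEA (hx E hE)) a ha

theorem isReplacementFamily_maxOrderAbelian {p : ℕ} [Fact p.Prime] (hodd : Odd p)
    {D : Subgroup G} (hD : IsPGroup p D) : IsReplacementFamily D (maxOrderAbelian D) where
  nonempty := maxOrderAbelian_nonempty D
  le A hA := hA.1.1
  comm A hA := hA.1.2
  conj A hA g hg := by
    rw [mem_maxOrderAbelian_iff] at hA ⊢
    exact ⟨map_conj_mem_abelianSubgroups hA.1 hg, by rw [card_map_conj]; exact hA.2⟩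
  replace A hA B hBn hBD hB hBA hn := by
    rw [mem_maxOrderAbelian_iff] at hA
    have hle : A ⊔ B ≤ D := sup_le hA.1.1 hBD
    obtain ⟨C, hC, hcomm, hcard, hlt, hCA, -⟩ :=
      exists_abelian_replacement hodd hA.1.2 (hD.to_le hle) hB hBA hn
    exact ⟨C, mem_maxOrderAbelian_iff.2 ⟨⟨hC.trans hle, hcomm⟩, fun E hE =>
      (hA.2 E hE).trans hcard⟩, hlt, hCA⟩

theorem isReplacementFamily_maxOrderElemAbelian {p : ℕ} [Fact p.Prime] (hodd : Odd p)
    {D : Subgroup G} (hD : IsPGroup p D) : IsReplacementFamily D (maxOrderElemAbelian p D) where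
  nonempty := maxOrderElemAbelian_nonempty p D
  le A hA := hA.1.1.1
  comm A hA := hA.1.1.2
  conj A hA g hg := by
    rw [mem_maxOrderElemAbelian_iff] at hA ⊢
    refine ⟨⟨map_conj_mem_abelianSubgroups hA.1.1 hg, ?_⟩, by rw [card_map_conj]; exact hA.2⟩
    rintro _ ⟨a, ha, rfl⟩
    rw [← map_pow, hA.1.2 a ha, map_one]
  replace A hA B hBn hBD hB hBA hn := by
    rw [mem_maxOrderElemAbelian_iff] at hA
    have hle : A ⊔ B ≤ D := sup_le hA.1.1.1 hBD
    obtain ⟨C, hC, hcomm, hcard, hlt, hCA, hexp⟩ :=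
      exists_abelian_replacement hodd hA.1.1.2 (hD.to_le hle) hB hBA hn
    exact ⟨C, mem_maxOrderElemAbelian_iff.2 ⟨⟨⟨hC.trans hle, hcomm⟩, hexp hA.1.2⟩, fun E hE =>
      (hA.2 E hE).trans hcard⟩, hlt, hCA⟩

end Families

end ThompsonZJ

theorem theoremB {G : Type*} [Group G] [Finite G] (p : ℕ) [Fact p.Prime] (hp : Odd p)
    (hstable : ThompsonZJ.IsPStable p G) (P : Sylow p G)
    (hcent : Subgroup.centralizer (ThompsonZJ.pCore p G : Set G) ≤ ThompsonZJ.pCore p G)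
    (D : Subgroup G) (hD : ThompsonZJ.IsStronglyClosed (P : Subgroup G) (D : Set G)) :
    (ThompsonZJ.centerOf (ThompsonZJ.thompsonO D)).Normal ∧
      (ThompsonZJ.omega p (ThompsonZJ.centerOf (ThompsonZJ.thompsonR D))).Normal ∧
      (ThompsonZJ.omega p (ThompsonZJ.centerOf (ThompsonZJ.thompsonE p D))).Normal := by
  have hDp : IsPGroup p D := P.isPGroup'.to_le hD.2.1
  have hO := ThompsonZJ.sInf_normal_of_isReplacementFamily hstable hcent hD
    (ThompsonZJ.isReplacementFamily_maxOrderAbelian hp hDp)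
  have hE := ThompsonZJ.sInf_normal_of_isReplacementFamily hstable hcent hD
    (ThompsonZJ.isReplacementFamily_maxOrderElemAbelian hp hDp)
  rw [ThompsonZJ.centerOf_thompsonO_eq_sInf, ThompsonZJ.omega_centerOf_thompsonR_eq_sInf hDp,
    ThompsonZJ.omega_centerOf_thompsonE_eq_sInf]
  exact ⟨hO, hE, hE⟩
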